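/- Let $d\ge 0$, let $\Omega\subset\mathbb R^d$ be a Borel set (for instance an open or a closed domain), let $|\cdot|$ be the Euclidean norm, and let $p\in[1,\infty)$. Let $\mathcal P(\Omega)$ be the set of Borel probability measures on $\Omega$, and for $\mu\in\mathcal P(\Omega)$ put $m_p(\mu)=\int_\Omega|x|^p\,d\mu(x)\in[0,\infty]$ and $\mathcal W_p(\Omega)=\{\mu\in\mathcal P(\Omega): m_p(\mu)<\infty\}$. For $\mu,\nu\in\mathcal P(\Omega)$ let $\Pi(\mu,\nu)$ be the set of Borel probability measures on $\Omega\times\Omega$ with first marginal $\mu$ and second marginal $\nu$, and $$W_p(\mu,\nu)=\Big(\min_{\gamma\in\Pi(\mu,\nu)}\int_{\Omega\times\Omega}|x-y|^p\,d\gamma(x,y)\Big)^{1/p}\in[0,\infty].$$ Then this minimum is attained for all $\mu,\nu\in\mathcal P(\Omega)$, and $W_p$ is a (finite) distance on $\mathcal W_p(\Omega)$. Moreover, for $\mu\in\mathcal W_p(\Omega)$ and a sequence $(\mu_n)_n$ in $\mathcal W_p(\Omega)$, the following are equivalent: (i) $W_p(\mu_n,\mu)\to0$; (ii) $\mu_n\rightharpoonup\mu$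 weakly (i.e. $\int_\Omega\phi\,d\mu_n\to\int_\Omega\phi\,d\mu$ for every bounded continuous $\phi:\Omega\to\mathbb R$) and $m_p(\mu_n)\to m_p(\mu)$; (iii) $\int_\Omega\phi\,d\mu_n\to\int_\Omega\phi\,d\mu$ for every continuous $\phi:\Omega\to\mathbb R$ for which there are constants $A,B$ with $|\phi(x)|\le A+B|x|^p$ for all $x\in\Omega$. -/

import Mathlib

open MeasureTheory Filter Topology
open scoped ENNReal

noncomputable section

namespace OptimalTransport

variable {d : ℕ} {Ω : Set (EuclideanSpace ℝ (Fin d))}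

/-- Transport plans `Π(μ, ν)`: probability measures on `Ω × Ω` with marginals `μ` and `ν`. -/
def transportPlans (μ ν : ProbabilityMeasure Ω) : Set (ProbabilityMeasure (Ω × Ω)) :=
  {γ | (γ : Measure (Ω × Ω)).map Prod.fst = (μ : Measure Ω) ∧
       (γ : Measure (Ω × Ω)).map Prod.snd = (ν : Measure Ω)}

/-- The cost `∫ |x - y| ^ p dγ` of a plan, in `[0, ∞]`. -/
def planCost (p : ℝ) (γ : ProbabilityMeasure (Ω × Ω)) : ℝ≥0∞ :=
  ∫⁻ z, ‖(z.1 : EuclideanSpace ℝ (Fin d)) - (z.2 : EuclideanSpace ℝ (Fin d))‖ₑ ^ p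
    ∂(γ : Measure (Ω × Ω))

/-- A plan solving the Kantorovich problem between `μ` and `ν` for the cost `|x - y| ^ p`. -/
def IsOptimalPlan (p : ℝ) (μ ν : ProbabilityMeasure Ω) (γ : ProbabilityMeasure (Ω × Ω)) : Prop :=
  γ ∈ transportPlans μ ν ∧ IsMinOn (planCost p) (transportPlans μ ν) γ

/-- `W_p(μ, ν)`, the `p`-th root of the value of the Kantorovich problem, in `[0, ∞]`. -/
def Wp (p : ℝ) (μ ν : ProbabilityMeasure Ω) : ℝ≥0∞ :=
  (⨅ γ ∈ transportPlans μ ν, planCost p γ) ^ (1 / p)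

/-- The `p`-th moment `m_p(μ) = ∫ |x| ^ p dμ`, in `[0, ∞]`. -/
def moment (p : ℝ) (μ : ProbabilityMeasure Ω) : ℝ≥0∞ :=
  ∫⁻ x, ‖(x : EuclideanSpace ℝ (Fin d))‖ₑ ^ p ∂(μ : Measure Ω)

/-- The probability measures on `Ω` with finite `p`-th moment. -/
def finiteMoment (p : ℝ) (Ω : Set (EuclideanSpace ℝ (Fin d))) : Set (ProbabilityMeasure Ω) :=
  {μ | moment p μ < ∞}

/-- `φ` has growth at most of order `p`. -/
def HasGrowth (p : ℝ) (φ : Ω → ℝ) : Prop :=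
  ∃ A B : ℝ, ∀ x : Ω, |φ x| ≤ A + B * ‖(x : EuclideanSpace ℝ (Fin d))‖ ^ p

end OptimalTransport

end

/-!
Optimal plans exist because the plans between two measures form a closed set, tight by the tightness
of the marginals on a Borel subset of `ℝ^d`, hence compact by Prokhorov's theorem, and the cost is
lower semicontinuous. The root of the cost of a plan is the `L^p` norm of `x - y`, so the triangle
inequality is Minkowski's inequality for two optimal plans glued along their common marginal.

Convergence in `W_p` implies weak convergence because `W_1 ≤ W_p` controls the integrals of
Lipschitz functions, and convergence of the moments because `m_p ^ (1 / p)` is `1`-Lipschitz for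
`W_p`. If `|φ| ≤ g` with `g = A + B |x| ^ p`, then `g + φ` and `g - φ` are nonnegative, so their
integrals are weakly lower semicontinuous; as `∫ g` converges, so does `∫ φ`.

Conversely, move all mass to a finite set `s` along a partition of unity subordinate to the almost
nearest points. This costs at most `∫ (dist(x, s) + ε) ^ p`, an integral of a function of order `p`,
which is small for `μ` when `s` is a large part of a dense sequence, and then also for `μ_n` with
`n` large. The quantised measures live on the common finite set `s` and their weights converge, so
their mutual distance tends to `0`.
-/

namespace OptimalTransport

open ProbabilityTheory
open scoped NNReal

section WeakConvergence

variable {X : Type*} [TopologicalSpace X] [MeasurableSpace X] [OpensMeasurableSpace X]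

theorem lowerSemicontinuous_lintegral {f : X → ℝ≥0∞} (hf : Continuous f) :
    LowerSemicontinuous fun μ : ProbabilityMeasure X => ∫⁻ x, f x ∂(μ : Measure X) := by
  have truncate (μ : ProbabilityMeasure X) :
      ∫⁻ x, f x ∂(μ : Measure X) = ⨆ n : ℕ, ∫⁻ x, min (f x) n ∂(μ : Measure X) := by
    rw [← lintegral_iSup (fun n => (hf.min continuous_const).measurable)
      fun m n hmn x => by dsimp only; gcongr]
    refine lintegral_congr fun x => ?_
    rw [← inf_iSup_eq, ENNReal.iSup_natCast, inf_top_eq]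
  simp_rw [truncate]
  refine lowerSemicontinuous_iSup fun n => Continuous.lowerSemicontinuous ?_
  have min_ne_top (x : X) : min (f x) n ≠ ∞ := ne_top_of_le_ne_top (by simp) (min_le_right _ _)
  have toNNReal_mem (x : X) : ((min (f x) n).toNNReal : ℝ) ∈ Set.Icc 0 (n : ℝ) :=
    ⟨NNReal.coe_nonneg _, by exact_mod_cast ENNReal.toNNReal_mono (by simp) (min_le_right (f x) n)⟩
  let g : BoundedContinuousFunction X ℝ≥0 := .mkOfBound
    ⟨fun x => (min (f x) n).toNNReal, ENNReal.continuousOn_toNNReal.comp_continuous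
      (hf.min continuous_const) min_ne_top⟩ n
    fun x y => (Real.dist_le_of_mem_Icc (toNNReal_mem x) (toNNReal_mem y)).trans_eq (sub_zero _)
  have coe_g (x : X) : (g x : ℝ≥0∞) = min (f x) n := ENNReal.coe_toNNReal (min_ne_top x)
  simp_rw [← coe_g]
  exact continuous_iff_continuousAt.2 fun μ =>
    ProbabilityMeasure.tendsto_iff_forall_lintegral_tendsto.1 (continuous_id.tendsto μ) g

theorem eventually_lt_integral {ι : Type*} {l : Filter ι} {μ : ProbabilityMeasure X}
    {μs : ι → ProbabilityMeasure X} (hμs : Tendsto μs l (𝓝 μ)) {f : X → ℝ} (hf : Continuous f)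
    (f_nonneg : ∀ x, 0 ≤ f x) (hfμ : Integrable f (μ : Measure X))
    (hfμs : ∀ i, Integrable f (μs i : Measure X)) {y : ℝ} (hy : y < ∫ x, f x ∂(μ : Measure X)) :
    ∀ᶠ i in l, y < ∫ x, f x ∂(μs i : Measure X) := by
  rcases lt_or_ge y 0 with y_neg | y_nonneg
  · exact Eventually.of_forall fun i => y_neg.trans_le (integral_nonneg f_nonneg)
  · have ofReal_lt_iff {ν : ProbabilityMeasure X} (hfν : Integrable f (ν : Measure X)) :
        ENNReal.ofReal y < ∫⁻ x, ENNReal.ofReal (f x) ∂(ν : Measure X) ↔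
          y < ∫ x, f x ∂(ν : Measure X) := by
      rw [← ofReal_integral_eq_lintegral_ofReal hfν (Eventually.of_forall f_nonneg),
        ENNReal.ofReal_lt_ofReal_iff_of_nonneg y_nonneg]
    have hlsc := lowerSemicontinuous_lintegral (ENNReal.continuous_ofReal.comp hf)
    exact (hμs.eventually (hlsc μ _ ((ofReal_lt_iff hfμ).2 hy))).mono
      fun i => (ofReal_lt_iff (hfμs i)).1

theorem tendsto_integral_of_abs_le {ι : Type*} {l : Filter ι} {μ : ProbabilityMeasure X}
    {μs : ι → ProbabilityMeasure X} (hμs : Tendsto μs l (𝓝 μ)) {φ g : X → ℝ}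
    (hφ : Continuous φ) (hg : Continuous g) (hφg : ∀ x, |φ x| ≤ g x)
    (hgμ : Integrable g (μ : Measure X)) (hgμs : ∀ i, Integrable g (μs i : Measure X))
    (hlim : Tendsto (fun i => ∫ x, g x ∂(μs i : Measure X)) l (𝓝 (∫ x, g x ∂(μ : Measure X)))) :
    Tendsto (fun i => ∫ x, φ x ∂(μs i : Measure X)) l (𝓝 (∫ x, φ x ∂(μ : Measure X))) := by
  have eventually_lt {ψ : X → ℝ} (hψ : Continuous ψ) (hψg : ∀ x, |ψ x| ≤ g x) {y : ℝ}
      (hy : y < ∫ x, ψ x ∂(μ : Measure X)) : ∀ᶠ i in l, y < ∫ x, ψ x ∂(μs i : Measure X) := by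
    have integrable {ν : Measure X} (hν : Integrable g ν) : Integrable ψ ν :=
      hν.mono' hψ.aestronglyMeasurable (Eventually.of_forall hψg)
    have integral_add_eq {ν : Measure X} (hν : Integrable g ν) :
        ∫ x, (g x + ψ x) ∂ν = ∫ x, g x ∂ν + ∫ x, ψ x ∂ν := integral_add hν (integrable hν)
    obtain ⟨δ, hδ, hyδ⟩ : ∃ δ > 0, y + δ < ∫ x, ψ x ∂(μ : Measure X) - δ :=
      ⟨(∫ x, ψ x ∂(μ : Measure X) - y) / 3, by linarith, by linarith⟩
    have h_sum := eventually_lt_integral hμs (f := fun x => g x + ψ x) (hg.add hψ)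
      (fun x => by linarith [neg_abs_le (ψ x), hψg x]) (hgμ.add (integrable hgμ))
      (fun i => (hgμs i).add (integrable (hgμs i)))
      (y := ∫ x, g x ∂(μ : Measure X) + y + δ) (by rw [integral_add_eq hgμ]; linarith)
    filter_upwards [h_sum, hlim.eventually_lt_const (lt_add_of_pos_right _ hδ)] with i h_lt h_gt
    rw [integral_add_eq (hgμs i)] at h_lt
    linarith
  refine tendsto_order.2 ⟨fun y => eventually_lt hφ hφg, fun y hy => ?_⟩
  have h_neg := eventually_lt hφ.neg (fun x => by simpa using hφg x) (y := -y)
    (by simpa [integral_neg] using hy)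
  simpa only [integral_neg, Pi.neg_apply, neg_lt_neg_iff] using h_neg

end WeakConvergence

theorem isTightMeasureSet_singleton_of_measurableSet {E : Type*} [TopologicalSpace E]
    [PolishSpace E] [MeasurableSpace E] [BorelSpace E] {s : Set E} (hs : MeasurableSet s)
    (μ : Measure s) [IsFiniteMeasure μ] : IsTightMeasureSet {μ} := by
  rw [isTightMeasureSet_iff_exists_isCompact_measure_compl_le]
  intro ε hε
  obtain ⟨K, hKs, hK, hKε⟩ :=
    hs.exists_isCompact_sdiff_lt (μ := μ.map Subtype.val) (measure_ne_top _ _) hε.ne'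
  refine ⟨Subtype.val ⁻¹' K,
    Topology.IsInducing.subtypeVal.isCompact_preimage' hK (by simpa using hKs), ?_⟩
  rintro _ rfl
  rw [Measure.map_apply measurable_subtype_coe (hs.diff hK.measurableSet)] at hKε
  have compl_subset : (Subtype.val ⁻¹' K : Set s)ᶜ ⊆ Subtype.val ⁻¹' (s \ K) :=
    fun x hx => ⟨x.2, hx⟩
  exact (measure_mono compl_subset).trans hKε.le

theorem exists_gluing {X Y Z : Type*} [MeasurableSpace X] [StandardBorelSpace X] [Nonempty X]
    [MeasurableSpace Y] [MeasurableSpace Z] (γ₁ : Measure (X × Y)) (γ₂ : Measure (Y × Z))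
    [IsFiniteMeasure γ₁] [IsFiniteMeasure γ₂] (h : γ₁.snd = γ₂.fst) :
    ∃ Γ : Measure (X × Y × Z),
      Γ.map (fun z => (z.1, z.2.1)) = γ₁ ∧ Γ.map Prod.snd = γ₂ := by
  set κ : Kernel Y X := (γ₁.map Prod.swap).condKernel
  have disintegrate : γ₂.fst ⊗ₘ κ = γ₁.map Prod.swap := by
    rw [← h, ← Measure.fst_map_swap]
    exact (γ₁.map Prod.swap).disintegrate κ
  have map_prodMap : (γ₂ ⊗ₘ κ.comap Prod.fst measurable_fst).map (Prod.map Prod.fst id) =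
      γ₂.fst ⊗ₘ κ := by
    ext t ht
    have hm : Measurable (Prod.map Prod.fst id : (Y × Z) × X → Y × X) := by fun_prop
    rw [Measure.map_apply hm ht, Measure.compProd_apply (hm ht), Measure.compProd_apply ht,
      Measure.fst, lintegral_map (Kernel.measurable_kernel_prodMk_left ht) measurable_fst]
    rfl
  refine ⟨(γ₂ ⊗ₘ κ.comap Prod.fst measurable_fst).map Prod.swap, ?_, ?_⟩
  · have := congrArg (Measure.map Prod.swap) (map_prodMap.trans disintegrate)
    rw [Measure.map_map measurable_swap (by fun_prop),
      Measure.map_map measurable_swap measurable_swap, Prod.swap_swap_eq, Measure.map_id] at this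
    rw [Measure.map_map (by fun_prop) measurable_swap]
    exact this
  · rw [Measure.map_map measurable_snd measurable_swap]
    exact Measure.fst_compProd _ _

section Net

variable {X : Type*}

theorem exists_partitionOfUnity_dist_lt_infDist_add [PseudoMetricSpace X] {ι : Type*} [Finite ι]
    [Nonempty ι] (e : ι → X) {ε : ℝ} (hε : 0 < ε) :
    ∃ f : PartitionOfUnity ι X Set.univ,
      ∀ i x, f i x ≠ 0 → dist x (e i) < Metric.infDist x (Set.range e) + ε := by
  let U (i : ι) : Set X := {x | dist x (e i) < Metric.infDist x (Set.range e) + ε}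
  have hU (i : ι) : IsOpen (U i) :=
    isOpen_lt (by fun_prop) ((Metric.continuous_infDist_pt _).add continuous_const)
  have univ_subset : Set.univ ⊆ ⋃ i, U i := fun x _ => by
    obtain ⟨_, ⟨i, rfl⟩, hi⟩ := (Metric.infDist_lt_iff (Set.range_nonempty e)).1
      (lt_add_of_pos_right (Metric.infDist x (Set.range e)) hε)
    exact Set.mem_iUnion.2 ⟨i, hi⟩
  obtain ⟨f, hf⟩ := PartitionOfUnity.exists_isSubordinate_of_locallyFinite isClosed_univ U hU
    (locallyFinite_of_finite U) univ_subset
  exact ⟨f, fun i x hx => hf i (subset_tsupport _ hx)⟩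

theorem exists_finset_lintegral_infDist_lt [PseudoMetricSpace X] [TopologicalSpace.SeparableSpace X]
    [MeasurableSpace X] [OpensMeasurableSpace X] {p : ℝ} (hp : 0 < p) (x₀ : X) (μ : Measure X)
    (hμ : ∫⁻ x, ENNReal.ofReal ((dist x x₀ + 1) ^ p) ∂μ ≠ ∞) {η : ℝ≥0∞} (hη : 0 < η) :
    ∃ s : Finset X, s.Nonempty ∧ ∃ ε > 0,
      ∫⁻ x, ENNReal.ofReal ((Metric.infDist x s + ε) ^ p) ∂μ < η := by
  classical
  have : Nonempty X := ⟨x₀⟩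
  let s (N : ℕ) : Finset X := insert x₀ ((Finset.range N).image (TopologicalSpace.denseSeq X))
  let ε (N : ℕ) : ℝ := 1 / (N + 1)
  have ε_pos (N : ℕ) : 0 < ε N := Nat.one_div_pos_of_nat
  have ε_le_one (N : ℕ) : ε N ≤ 1 := by
    simpa [ε] using inv_le_one_of_one_le₀ (by simp : (1 : ℝ) ≤ N + 1)
  have infDist_tendsto (x : X) : Tendsto (fun N => Metric.infDist x (s N)) atTop (𝓝 0) := by
    refine tendsto_order.2 ⟨fun a ha => Eventually.of_forall fun N =>
      ha.trans_le Metric.infDist_nonneg, fun a ha => ?_⟩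
    obtain ⟨k, hk⟩ := (TopologicalSpace.denseRange_denseSeq X).exists_dist_lt x ha
    filter_upwards [eventually_gt_atTop k] with N hN
    refine (Metric.infDist_le_dist_of_mem ?_).trans_lt hk
    exact Finset.mem_insert_of_mem (Finset.mem_image_of_mem _ (Finset.mem_range.2 hN))
  have lintegral_tendsto : Tendsto
      (fun N => ∫⁻ x, ENNReal.ofReal ((Metric.infDist x (s N) + ε N) ^ p) ∂μ) atTop
      (𝓝 (∫⁻ _, 0 ∂μ)) := by
    refine tendsto_lintegral_of_dominated_convergence
      (fun x => ENNReal.ofReal ((dist x x₀ + 1) ^ p)) (fun N => ?_)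
      (fun N => Eventually.of_forall fun x => ?_) hμ (Eventually.of_forall fun x => ?_)
    · have := (Metric.continuous_infDist_pt (s N : Set X)).measurable
      fun_prop
    · have infDist_le : Metric.infDist x (s N) ≤ dist x x₀ :=
        Metric.infDist_le_dist_of_mem (Finset.mem_insert_self _ _)
      exact ENNReal.ofReal_le_ofReal (Real.rpow_le_rpow
        (add_nonneg Metric.infDist_nonneg (ε_pos N).le) (add_le_add infDist_le (ε_le_one N)) hp.le)
    · have h := ((infDist_tendsto x).add tendsto_one_div_add_atTop_nhds_zero_nat).rpow_const
        (p := p) (Or.inr hp.le)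
      simpa [ε, hp.ne', Function.comp_def] using (ENNReal.continuous_ofReal.tendsto _).comp h
  rw [lintegral_zero] at lintegral_tendsto
  obtain ⟨N, hN⟩ := (lintegral_tendsto.eventually_lt_const hη).exists
  exact ⟨s N, Finset.insert_nonempty _ _, ε N, ε_pos N, hN⟩

end Net

theorem sum_ofReal_partitionOfUnity {X ι : Type*} [TopologicalSpace X] [Fintype ι]
    (f : PartitionOfUnity ι X Set.univ) (x : X) : ∑ i, ENNReal.ofReal (f i x) = 1 := by
  rw [← ENNReal.ofReal_sum_of_nonneg fun i _ => f.nonneg i x, ← finsum_eq_sum_of_fintype,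
    f.sum_eq_one (Set.mem_univ x), ENNReal.ofReal_one]

section Quantization

variable {X ι : Type*} [TopologicalSpace X] [MeasurableSpace X] [OpensMeasurableSpace X] [Fintype ι]
  (f : PartitionOfUnity ι X Set.univ) (e : ι → X)

/-- The Markov kernel that sends each point `x` to one of the nodes `e i`, with the weights `f i x`
of a continuous partition of unity. -/
noncomputable def quantizationKernel : Kernel X X where
  toFun x := ∑ i, ENNReal.ofReal (f i x) • Measure.dirac (e i)
  measurable' := Measure.measurable_of_measurable_coe _ fun s _ => by
    simp only [Measure.finsetSum_apply, Measure.smul_apply, smul_eq_mul]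
    fun_prop

theorem quantizationKernel_apply (x : X) :
    quantizationKernel f e x = ∑ i, ENNReal.ofReal (f i x) • Measure.dirac (e i) := rfl

instance isMarkovKernel_quantizationKernel : IsMarkovKernel (quantizationKernel f e) where
  isProbabilityMeasure x :=
    ⟨by simp [quantizationKernel_apply, sum_ofReal_partitionOfUnity]⟩

/-- The finitely supported approximation of `μ` obtained by moving its mass to the nodes `e i` along
`quantizationKernel f e`. -/
noncomputable def quantize (μ : ProbabilityMeasure X) : ProbabilityMeasure X :=
  ⟨quantizationKernel f e ∘ₘ (μ : Measure X), inferInstance⟩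

theorem toMeasure_quantize (μ : ProbabilityMeasure X) :
    (quantize f e μ : Measure X) =
      ∑ i, (∫⁻ x, ENNReal.ofReal (f i x) ∂(μ : Measure X)) • Measure.dirac (e i) := by
  ext s hs
  simp only [quantize, ProbabilityMeasure.coe_mk, Measure.bind_apply hs (Kernel.aemeasurable _),
    quantizationKernel_apply, Measure.finsetSum_apply, Measure.smul_apply, smul_eq_mul]
  rw [lintegral_finsetSum _ fun i _ => by fun_prop]
  exact Finset.sum_congr rfl fun i _ => lintegral_mul_const _ (by fun_prop)

theorem ae_mem_range_quantize [MeasurableSingletonClass X] (μ : ProbabilityMeasure X) :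
    ∀ᵐ x ∂(quantize f e μ : Measure X), x ∈ Set.range e := by
  simp [toMeasure_quantize, ae_iff, Measure.finsetSum_apply]

theorem smul_quantize_le {c : ℝ≥0∞} {μ ν : ProbabilityMeasure X}
    (h : ∀ i, c * ∫⁻ x, ENNReal.ofReal (f i x) ∂(μ : Measure X) ≤
      ∫⁻ x, ENNReal.ofReal (f i x) ∂(ν : Measure X)) :
    c • (quantize f e μ : Measure X) ≤ quantize f e ν := by
  simp only [toMeasure_quantize, Finset.smul_sum, smul_smul]
  refine Finset.sum_le_sum fun i _ => Measure.le_iff.2 fun s _ => ?_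
  simp only [Measure.smul_apply, smul_eq_mul]
  gcongr
  exact h i

theorem eventually_smul_quantize_le {κ : Type*} {l : Filter κ} {c : ℝ≥0∞} (hc : c < 1)
    {μ : ProbabilityMeasure X} {μs : κ → ProbabilityMeasure X} (hμs : Tendsto μs l (𝓝 μ)) :
    ∀ᶠ n in l, c • (quantize f e μ : Measure X) ≤ quantize f e (μs n) := by
  suffices h : ∀ i, ∀ᶠ n in l, c * ∫⁻ x, ENNReal.ofReal (f i x) ∂(μ : Measure X) ≤
      ∫⁻ x, ENNReal.ofReal (f i x) ∂(μs n : Measure X) from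
    (eventually_all.2 h).mono fun n => smul_quantize_le f e
  intro i
  rcases eq_or_ne (∫⁻ x, ENNReal.ofReal (f i x) ∂(μ : Measure X)) 0 with h_zero | h_ne
  · simp [h_zero]
  · have h_le : ∫⁻ x, ENNReal.ofReal (f i x) ∂(μ : Measure X) ≤ 1 :=
      (lintegral_mono fun x => ENNReal.ofReal_le_one.2 (f.le_one i x)).trans_eq (by simp)
    have h_lt : c * ∫⁻ x, ENNReal.ofReal (f i x) ∂(μ : Measure X) <
        ∫⁻ x, ENNReal.ofReal (f i x) ∂(μ : Measure X) := by
      simpa using ENNReal.mul_lt_mul_left h_ne (h_le.trans_lt ENNReal.one_lt_top).ne hc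
    have hlsc := lowerSemicontinuous_lintegral (X := X)
      (ENNReal.continuous_ofReal.comp (f i).continuous)
    exact (hμs.eventually (hlsc μ _ h_lt)).mono fun n => le_of_lt

end Quantization

variable {d : ℕ} {Ω : Set (EuclideanSpace ℝ (Fin d))} {p : ℝ} {μ ν ρ : ProbabilityMeasure Ω}

theorem isClosed_transportPlans (μ ν : ProbabilityMeasure Ω) : IsClosed (transportPlans μ ν) := by
  have h_fst : IsClosed {γ : ProbabilityMeasure (Ω × Ω) | γ.map measurable_fst.aemeasurable = μ} :=
    isClosed_eq (ProbabilityMeasure.continuous_map continuous_fst) continuous_const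
  have h_snd : IsClosed {γ : ProbabilityMeasure (Ω × Ω) | γ.map measurable_snd.aemeasurable = ν} :=
    isClosed_eq (ProbabilityMeasure.continuous_map continuous_snd) continuous_const
  convert! h_fst.inter h_snd using 1
  ext γ
  exact and_congr (Subtype.ext_iff (a1 := γ.map measurable_fst.aemeasurable)).symm
    (Subtype.ext_iff (a1 := γ.map measurable_snd.aemeasurable)).symm

theorem isCompact_transportPlans (hΩ : MeasurableSet Ω) (μ ν : ProbabilityMeasure Ω) :
    IsCompact (transportPlans μ ν) := by
  rw [← (isClosed_transportPlans μ ν).closure_eq]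
  refine isCompact_closure_of_isTightMeasureSet (IsTightMeasureSet.prodMk ?_ ?_)
  · refine (isTightMeasureSet_singleton_of_measurableSet hΩ (μ : Measure Ω)).subset ?_
    rintro _ ⟨_, ⟨γ, hγ, rfl⟩, rfl⟩
    exact hγ.1
  · refine (isTightMeasureSet_singleton_of_measurableSet hΩ (ν : Measure Ω)).subset ?_
    rintro _ ⟨_, ⟨γ, hγ, rfl⟩, rfl⟩
    exact hγ.2

theorem prod_mem_transportPlans (μ ν : ProbabilityMeasure Ω) : μ.prod ν ∈ transportPlans μ ν := by
  constructor <;> simp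

theorem lowerSemicontinuous_planCost (p : ℝ) :
    LowerSemicontinuous (planCost p : ProbabilityMeasure (Ω × Ω) → ℝ≥0∞) :=
  lowerSemicontinuous_lintegral
    ((ENNReal.continuous_rpow_const (y := p)).comp (by fun_prop))

theorem exists_isOptimalPlan (hΩ : MeasurableSet Ω) (p : ℝ) (μ ν : ProbabilityMeasure Ω) :
    ∃ γ, IsOptimalPlan p μ ν γ :=
  LowerSemicontinuousOn.exists_isMinOn ⟨_, prod_mem_transportPlans μ ν⟩
    (isCompact_transportPlans hΩ μ ν) ((lowerSemicontinuous_planCost p).lowerSemicontinuousOn _)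

/-- The displacement `x - y` of a pair `(x, y)`. The `p`-th root of the cost of a plan is its `L^p`
norm, so that Minkowski's inequality applies to it. -/
def displacement (z : Ω × Ω) : EuclideanSpace ℝ (Fin d) := z.1 - z.2

@[fun_prop]
theorem continuous_displacement : Continuous (displacement : Ω × Ω → _) := by
  unfold displacement; fun_prop

theorem lintegral_enorm_rpow_eq_eLpNorm {α F : Type*} [MeasurableSpace α] [NormedAddCommGroup F]
    (hp : 0 < p) (f : α → F) (μ : Measure α) :
    (∫⁻ a, ‖f a‖ₑ ^ p ∂μ) ^ (1 / p) = eLpNorm f (ENNReal.ofReal p) μ := by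
  rw [eLpNorm_eq_lintegral_rpow_enorm_toReal (by simpa using hp) ENNReal.ofReal_ne_top,
    ENNReal.toReal_ofReal hp.le]

theorem planCost_rpow_eq_eLpNorm (hp : 0 < p) (γ : ProbabilityMeasure (Ω × Ω)) :
    planCost p γ ^ (1 / p) = eLpNorm displacement (ENNReal.ofReal p) (γ : Measure (Ω × Ω)) :=
  lintegral_enorm_rpow_eq_eLpNorm hp _ _

theorem moment_rpow_eq_eLpNorm (hp : 0 < p) (μ : ProbabilityMeasure Ω) :
    moment p μ ^ (1 / p) = eLpNorm Subtype.val (ENNReal.ofReal p) (μ : Measure Ω) :=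
  lintegral_enorm_rpow_eq_eLpNorm hp _ _

theorem Wp_le_planCost_rpow (hp : 0 ≤ p) {γ : ProbabilityMeasure (Ω × Ω)}
    (hγ : γ ∈ transportPlans μ ν) : Wp p μ ν ≤ planCost p γ ^ (1 / p) :=
  ENNReal.rpow_le_rpow (iInf₂_le γ hγ) (by positivity)

theorem Wp_le_eLpNorm (hp : 0 < p) {γ : ProbabilityMeasure (Ω × Ω)} (hγ : γ ∈ transportPlans μ ν) :
    Wp p μ ν ≤ eLpNorm displacement (ENNReal.ofReal p) (γ : Measure (Ω × Ω)) :=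
  (Wp_le_planCost_rpow hp.le hγ).trans_eq (planCost_rpow_eq_eLpNorm hp γ)

theorem le_Wp (hp : 0 < p) {a : ℝ≥0∞} (h : ∀ γ ∈ transportPlans μ ν,
      a ≤ eLpNorm displacement (ENNReal.ofReal p) (γ : Measure (Ω × Ω))) :
    a ≤ Wp p μ ν := by
  rw [Wp, one_div, ENNReal.le_rpow_inv_iff hp]
  refine le_iInf₂ fun γ hγ => ?_
  rw [← ENNReal.le_rpow_inv_iff hp, ← one_div, planCost_rpow_eq_eLpNorm hp]
  exact h γ hγ

theorem IsOptimalPlan.Wp_eq_eLpNorm (hp : 0 < p) {γ : ProbabilityMeasure (Ω × Ω)}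
    (hγ : IsOptimalPlan p μ ν γ) :
    Wp p μ ν = eLpNorm displacement (ENNReal.ofReal p) (γ : Measure (Ω × Ω)) := by
  rw [← planCost_rpow_eq_eLpNorm hp, Wp, ← hγ.2.iInf_eq hγ.1, iInf_subtype']

theorem Wp_comm (μ ν : ProbabilityMeasure Ω) : Wp p μ ν = Wp p ν μ := by
  suffices h : ∀ μ ν : ProbabilityMeasure Ω, ⨅ γ ∈ transportPlans μ ν, planCost p γ ≤
      ⨅ γ ∈ transportPlans ν μ, planCost p γ from congrArg (· ^ (1 / p)) ((h _ _).antisymm (h _ _))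
  refine fun μ ν => le_iInf₂ fun γ hγ => ?_
  have h_swap : γ.map measurable_swap.aemeasurable ∈ transportPlans μ ν :=
    ⟨(Measure.map_map measurable_fst measurable_swap).trans hγ.2,
      (Measure.map_map measurable_snd measurable_swap).trans hγ.1⟩
  refine (iInf₂_le _ h_swap).trans_eq ?_
  simp only [planCost, ProbabilityMeasure.toMeasure_map]
  rw [lintegral_map (by fun_prop) measurable_swap]
  simp only [Prod.fst_swap, Prod.snd_swap, enorm_sub_rev]

theorem Wp_comp_le (hp : 0 ≤ p) (κ : Kernel Ω Ω) [IsMarkovKernel κ] (h : κ ∘ₘ (μ : Measure Ω) = ν) :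
    Wp p μ ν ≤ (∫⁻ x, ∫⁻ y, edist x y ^ p ∂κ x ∂(μ : Measure Ω)) ^ (1 / p) := by
  let γ : ProbabilityMeasure (Ω × Ω) := ⟨(μ : Measure Ω) ⊗ₘ κ, inferInstance⟩
  have hγ : γ ∈ transportPlans μ ν :=
    ⟨Measure.fst_compProd _ _, (Measure.snd_compProd _ _).trans h⟩
  refine (Wp_le_planCost_rpow hp hγ).trans_eq (congrArg (· ^ (1 / p)) ?_)
  simp only [Subtype.edist_eq, edist_eq_enorm_sub]
  exact Measure.lintegral_compProd (by fun_prop)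

theorem exists_gluing_transportPlans (hΩ : MeasurableSet Ω) {γ₁ γ₂ : ProbabilityMeasure (Ω × Ω)}
    (h₁ : γ₁ ∈ transportPlans μ ν) (h₂ : γ₂ ∈ transportPlans ν ρ) :
    ∃ Γ : ProbabilityMeasure (Ω × Ω × Ω),
      (Γ : Measure (Ω × Ω × Ω)).map (fun z => (z.1, z.2.1)) = γ₁ ∧
      (Γ : Measure (Ω × Ω × Ω)).map Prod.snd = γ₂ ∧
      Γ.map (f := fun z => (z.1, z.2.2)) (by fun_prop) ∈ transportPlans μ ρ := by
  have := hΩ.standardBorel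
  have : Nonempty Ω := μ.nonempty
  obtain ⟨Γ, hΓ₁, hΓ₂⟩ := exists_gluing (γ₁ : Measure (Ω × Ω)) (γ₂ : Measure (Ω × Ω))
    (h₁.2.trans h₂.1.symm)
  have isProbabilityMeasure : IsProbabilityMeasure Γ :=
    have : IsProbabilityMeasure (Γ.map Prod.snd) := hΓ₂ ▸ inferInstance
    Measure.isProbabilityMeasure_of_map (f := Prod.snd)
  refine ⟨⟨Γ, isProbabilityMeasure⟩, hΓ₁, hΓ₂, ?_, ?_⟩
  · rw [← h₁.1, ← hΓ₁, Measure.map_map (by fun_prop) (by fun_prop)]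
    exact Measure.map_map (by fun_prop) (by fun_prop)
  · rw [← h₂.2, ← hΓ₂, Measure.map_map (by fun_prop) (by fun_prop)]
    exact Measure.map_map (by fun_prop) (by fun_prop)

theorem Wp_triangle (hΩ : MeasurableSet Ω) (hp : 1 ≤ p) (μ ν ρ : ProbabilityMeasure Ω) :
    Wp p μ ρ ≤ Wp p μ ν + Wp p ν ρ := by
  have hp0 : 0 < p := by linarith
  obtain ⟨γ₁, h₁⟩ := exists_isOptimalPlan hΩ p μ ν
  obtain ⟨γ₂, h₂⟩ := exists_isOptimalPlan hΩ p ν ρ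
  obtain ⟨Γ, hΓ₁, hΓ₂, hΓ⟩ := exists_gluing_transportPlans hΩ h₁.1 h₂.1
  rw [h₁.Wp_eq_eLpNorm hp0, h₂.Wp_eq_eLpNorm hp0, ← hΓ₁, ← hΓ₂,
    eLpNorm_map_measure (by fun_prop) (by fun_prop),
    eLpNorm_map_measure (by fun_prop) (by fun_prop)]
  refine (Wp_le_eLpNorm hp0 hΓ).trans ?_
  rw [ProbabilityMeasure.toMeasure_map, eLpNorm_map_measure (by fun_prop) (by fun_prop)]
  have displacement_add : (displacement ∘ fun z : Ω × Ω × Ω => (z.1, z.2.2)) =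
      (displacement ∘ fun z => (z.1, z.2.1)) + displacement ∘ Prod.snd :=
    funext fun z => (sub_add_sub_cancel _ _ _).symm
  rw [displacement_add]
  exact eLpNorm_add_le (by fun_prop) (by fun_prop) (by simpa using hp)

theorem Wp_self (hp : 0 < p) (μ : ProbabilityMeasure Ω) : Wp p μ μ = 0 := by
  have h := Wp_comp_le hp.le (μ := μ) (ν := μ) Kernel.id Measure.id_comp
  simpa [Kernel.id_apply, lintegral_dirac, hp] using h

theorem Wp_le_Wp_of_exponent_le {q : ℝ} (hp : 0 < p) (hpq : p ≤ q) (μ ν : ProbabilityMeasure Ω) :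
    Wp p μ ν ≤ Wp q μ ν :=
  le_Wp (hp.trans_le hpq) fun _ hγ => (Wp_le_eLpNorm hp hγ).trans
    (eLpNorm_le_eLpNorm_of_exponent_le (ENNReal.ofReal_le_ofReal hpq) (by fun_prop))

theorem edist_integral_le_mul_eLpNorm {K : ℝ≥0} {f : Ω → ℝ} (hf : LipschitzWith K f)
    (hfμ : Integrable f (μ : Measure Ω)) (hfν : Integrable f (ν : Measure Ω))
    {γ : ProbabilityMeasure (Ω × Ω)} (hγ : γ ∈ transportPlans μ ν) :
    edist (∫ x, f x ∂(μ : Measure Ω)) (∫ x, f x ∂(ν : Measure Ω)) ≤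
      K * eLpNorm displacement 1 (γ : Measure (Ω × Ω)) := by
  have hf_fst : Integrable (fun z => f z.1) (γ : Measure (Ω × Ω)) :=
    Integrable.comp_measurable (hγ.1.symm ▸ hfμ) measurable_fst
  have hf_snd : Integrable (fun z => f z.2) (γ : Measure (Ω × Ω)) :=
    Integrable.comp_measurable (hγ.2.symm ▸ hfν) measurable_snd
  have hf_meas {ρ : Measure Ω} : AEStronglyMeasurable f ρ := hf.continuous.aestronglyMeasurable
  calc edist (∫ x, f x ∂(μ : Measure Ω)) (∫ x, f x ∂(ν : Measure Ω))
      = ‖∫ z, (f z.1 - f z.2) ∂(γ : Measure (Ω × Ω))‖ₑ := by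
        rw [integral_sub hf_fst hf_snd, ← hγ.1, ← hγ.2, integral_map (by fun_prop) hf_meas,
          integral_map (by fun_prop) hf_meas, edist_eq_enorm_sub]
    _ ≤ ∫⁻ z, ‖f z.1 - f z.2‖ₑ ∂(γ : Measure (Ω × Ω)) := enorm_integral_le_lintegral_enorm _
    _ ≤ ∫⁻ z, K * ‖displacement z‖ₑ ∂(γ : Measure (Ω × Ω)) := lintegral_mono fun z => by
        simpa only [displacement, edist_eq_enorm_sub, Subtype.edist_eq] using hf z.1 z.2
    _ = K * eLpNorm displacement 1 (γ : Measure (Ω × Ω)) := by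
        rw [lintegral_const_mul _ (by fun_prop), eLpNorm_one_eq_lintegral_enorm]

theorem edist_integral_le_mul_Wp_one {K : ℝ≥0} {f : Ω → ℝ} (hf : LipschitzWith K f)
    (hfμ : Integrable f (μ : Measure Ω)) (hfν : Integrable f (ν : Measure Ω)) :
    edist (∫ x, f x ∂(μ : Measure Ω)) (∫ x, f x ∂(ν : Measure Ω)) ≤ K * Wp 1 μ ν := by
  rcases eq_or_ne K 0 with rfl | hK
  · simpa using edist_integral_le_mul_eLpNorm hf hfμ hfν (prod_mem_transportPlans μ ν)
  · rw [mul_comm, ← ENNReal.div_le_iff_le_mul (by simp [hK]) (by simp)]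
    refine le_Wp one_pos fun γ hγ => ENNReal.div_le_of_le_mul' ?_
    simpa using edist_integral_le_mul_eLpNorm hf hfμ hfν hγ

theorem tendsto_of_tendsto_Wp {ι : Type*} {l : Filter ι} [l.IsCountablyGenerated] (hp : 1 ≤ p)
    {μs : ι → ProbabilityMeasure Ω} (h : Tendsto (fun i => Wp p (μs i) μ) l (𝓝 0)) :
    Tendsto μs l (𝓝 μ) := by
  rw [tendsto_iff_forall_lipschitz_integral_tendsto]
  rintro f ⟨C, hC⟩ ⟨K, hK⟩
  have integrable (ν : ProbabilityMeasure Ω) : Integrable f (ν : Measure Ω) :=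
    (BoundedContinuousFunction.mkOfBound ⟨f, hK.continuous⟩ C hC).integrable _
  rw [tendsto_iff_edist_tendsto_0]
  have hK_tendsto : Tendsto (fun i => K * Wp p (μs i) μ) l (𝓝 0) := by
    simpa using ENNReal.Tendsto.const_mul h (Or.inr ENNReal.coe_ne_top)
  refine tendsto_of_tendsto_of_tendsto_of_le_of_le tendsto_const_nhds hK_tendsto
    (fun _ => zero_le) fun i => ?_
  refine (edist_integral_le_mul_Wp_one hK (integrable _) (integrable _)).trans ?_
  gcongr
  exact Wp_le_Wp_of_exponent_le one_pos hp _ _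

theorem Wp_eq_zero_iff (hp : 1 ≤ p) : Wp p μ ν = 0 ↔ μ = ν := by
  refine ⟨fun h => ?_, ?_⟩
  · have h_const : Tendsto (fun _ : ℕ => μ) atTop (𝓝 ν) :=
      tendsto_of_tendsto_Wp hp (by simp [h])
    exact tendsto_nhds_unique tendsto_const_nhds h_const
  · rintro rfl
    exact Wp_self (by linarith) μ

theorem eLpNorm_val_comp {α : Type*} [MeasurableSpace α] {γ : Measure α} {f : α → Ω}
    (hf : Measurable f) (h : γ.map f = μ) (q : ℝ≥0∞) :
    eLpNorm (fun z => (f z : EuclideanSpace ℝ (Fin d))) q γ =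
      eLpNorm Subtype.val q (μ : Measure Ω) := by
  rw [← h, eLpNorm_map_measure (by fun_prop) hf.aemeasurable, Function.comp_def]

theorem moment_rpow_le (hp : 1 ≤ p) (μ ν : ProbabilityMeasure Ω) :
    moment p μ ^ (1 / p) ≤ Wp p μ ν + moment p ν ^ (1 / p) := by
  have hp0 : 0 < p := by linarith
  rw [← tsub_le_iff_right]
  refine le_Wp hp0 fun γ hγ => ?_
  rw [tsub_le_iff_right, moment_rpow_eq_eLpNorm hp0, moment_rpow_eq_eLpNorm hp0,
    ← eLpNorm_val_comp measurable_fst hγ.1, ← eLpNorm_val_comp measurable_snd hγ.2]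
  have val_fst : (fun z : Ω × Ω => (z.1 : EuclideanSpace ℝ (Fin d))) =
      displacement + fun z => (z.2 : EuclideanSpace ℝ (Fin d)) :=
    funext fun z => (sub_add_cancel _ _).symm
  rw [val_fst]
  exact eLpNorm_add_le (by fun_prop) (by fun_prop) (by simpa using hp)

theorem Wp_lt_top (hp : 1 ≤ p) (hμ : moment p μ < ∞) (hν : moment p ν < ∞) : Wp p μ ν < ∞ := by
  have hp0 : 0 < p := by linarith
  have hγ := prod_mem_transportPlans μ ν
  refine (Wp_le_eLpNorm hp0 hγ).trans_lt
    ((eLpNorm_sub_le (by fun_prop) (by fun_prop) (by simpa using hp)).trans_lt ?_)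
  rw [eLpNorm_val_comp measurable_fst hγ.1, eLpNorm_val_comp measurable_snd hγ.2,
    ← moment_rpow_eq_eLpNorm hp0, ← moment_rpow_eq_eLpNorm hp0]
  exact ENNReal.add_lt_top.2 ⟨ENNReal.rpow_lt_top_of_nonneg (by positivity) hμ.ne,
    ENNReal.rpow_lt_top_of_nonneg (by positivity) hν.ne⟩

theorem tendsto_moment_of_tendsto_Wp {ι : Type*} {l : Filter ι} (hp : 1 ≤ p)
    {μs : ι → ProbabilityMeasure Ω} (h : Tendsto (fun i => Wp p (μs i) μ) l (𝓝 0)) :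
    Tendsto (fun i => moment p (μs i)) l (𝓝 (moment p μ)) := by
  have lower : Tendsto (fun i => moment p μ ^ (1 / p) - Wp p (μs i) μ) l
      (𝓝 (moment p μ ^ (1 / p))) := by
    simpa using ENNReal.Tendsto.sub tendsto_const_nhds h (Or.inr ENNReal.zero_ne_top)
  have upper : Tendsto (fun i => Wp p (μs i) μ + moment p μ ^ (1 / p)) l
      (𝓝 (moment p μ ^ (1 / p))) := by
    simpa using h.add tendsto_const_nhds
  have root : Tendsto (fun i => moment p (μs i) ^ (1 / p)) l (𝓝 (moment p μ ^ (1 / p))) := by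
    refine tendsto_of_tendsto_of_tendsto_of_le_of_le lower upper (fun i => ?_)
      fun i => moment_rpow_le hp _ _
    rw [tsub_le_iff_left, Wp_comm]
    exact moment_rpow_le hp _ _
  have hp0 : p ≠ 0 := by linarith
  simpa [← ENNReal.rpow_mul, hp0] using root.ennrpow_const p

theorem integrable_norm_rpow (hp : 0 ≤ p) (hμ : moment p μ < ∞) :
    Integrable (fun x : Ω => ‖(x : EuclideanSpace ℝ (Fin d))‖ ^ p) (μ : Measure Ω) := by
  refine ⟨by fun_prop, ?_⟩
  simpa [HasFiniteIntegral, Real.enorm_rpow_of_nonneg, hp, moment] using hμ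

theorem integral_norm_rpow (hp : 0 ≤ p) (μ : ProbabilityMeasure Ω) :
    ∫ x : Ω, ‖(x : EuclideanSpace ℝ (Fin d))‖ ^ p ∂(μ : Measure Ω) = (moment p μ).toReal := by
  rw [integral_eq_lintegral_of_nonneg_ae (Eventually.of_forall fun x => by positivity)
    (by fun_prop), moment]
  simp [← ENNReal.ofReal_rpow_of_nonneg, hp, ofReal_norm]

theorem HasGrowth.integrable (hp : 0 ≤ p) {φ : Ω → ℝ} (hφ : HasGrowth p φ) (hc : Continuous φ)
    (hμ : moment p μ < ∞) : Integrable φ (μ : Measure Ω) := by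
  obtain ⟨A, B, h⟩ := hφ
  exact ((integrable_const A).add ((integrable_norm_rpow hp hμ).const_mul B)).mono'
    hc.aestronglyMeasurable (Eventually.of_forall h)

theorem tendsto_integral_of_hasGrowth {ι : Type*} {l : Filter ι} (hp : 0 ≤ p)
    {μs : ι → ProbabilityMeasure Ω} (hμ : moment p μ < ∞) (hμs : ∀ i, moment p (μs i) < ∞)
    (hw : Tendsto μs l (𝓝 μ)) (hm : Tendsto (fun i => moment p (μs i)) l (𝓝 (moment p μ)))
    {φ : Ω → ℝ} (hc : Continuous φ) (hφ : HasGrowth p φ) :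
    Tendsto (fun i => ∫ x, φ x ∂(μs i : Measure Ω)) l (𝓝 (∫ x, φ x ∂(μ : Measure Ω))) := by
  obtain ⟨A, B, h⟩ := hφ
  have integrable {ν : ProbabilityMeasure Ω} (hν : moment p ν < ∞) :
      Integrable (fun x : Ω => A + B * ‖(x : EuclideanSpace ℝ (Fin d))‖ ^ p) (ν : Measure Ω) :=
    (integrable_const A).add ((integrable_norm_rpow hp hν).const_mul B)
  have integral_eq {ν : ProbabilityMeasure Ω} (hν : moment p ν < ∞) :
      ∫ x : Ω, (A + B * ‖(x : EuclideanSpace ℝ (Fin d))‖ ^ p) ∂(ν : Measure Ω) =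
        A + B * (moment p ν).toReal := by
    rw [integral_add (integrable_const A) ((integrable_norm_rpow hp hν).const_mul B),
      integral_const_mul, integral_norm_rpow hp]
    simp
  refine tendsto_integral_of_abs_le hw hc ?_ h (integrable hμ) (fun i => integrable (hμs i)) ?_
  · fun_prop (disch := simp [hp])
  · simp only [integral_eq hμ, fun i => integral_eq (hμs i)]
    exact (((ENNReal.tendsto_toReal hμ.ne).comp hm).const_mul B).const_add A

theorem hasGrowth_rpow_of_lipschitzWith (hp : 1 ≤ p) {K : ℝ≥0} {g : Ω → ℝ} (hg : LipschitzWith K g)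
    (g_nonneg : ∀ x, 0 ≤ g x) : HasGrowth p fun x => g x ^ p := by
  rcases isEmpty_or_nonempty Ω with h_empty | ⟨⟨x₀⟩⟩
  · exact ⟨0, 0, fun x => h_empty.elim x⟩
  set R : ℝ := g x₀ + K * ‖(x₀ : EuclideanSpace ℝ (Fin d))‖
  have R_nonneg : 0 ≤ R := add_nonneg (g_nonneg x₀) (by positivity)
  refine ⟨2 ^ (p - 1) * R ^ p, 2 ^ (p - 1) * K ^ p, fun x => ?_⟩
  have g_le : g x ≤ R + K * ‖(x : EuclideanSpace ℝ (Fin d))‖ := by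
    have dist_le : dist x x₀ ≤
        ‖(x : EuclideanSpace ℝ (Fin d))‖ + ‖(x₀ : EuclideanSpace ℝ (Fin d))‖ :=
      dist_le_norm_add_norm (x : EuclideanSpace ℝ (Fin d)) x₀
    have := hg.le_add_mul x x₀
    nlinarith [K.coe_nonneg]
  have add_rpow_le : (R + K * ‖(x : EuclideanSpace ℝ (Fin d))‖) ^ p ≤
      2 ^ (p - 1) * (R ^ p + (K * ‖(x : EuclideanSpace ℝ (Fin d))‖) ^ p) := by
    exact_mod_cast NNReal.rpow_add_le_mul_rpow_add_rpow ⟨R, R_nonneg⟩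
      (K * ‖(x : EuclideanSpace ℝ (Fin d))‖₊) hp
  rw [abs_of_nonneg (Real.rpow_nonneg (g_nonneg x) p)]
  calc g x ^ p ≤ (R + K * ‖(x : EuclideanSpace ℝ (Fin d))‖) ^ p :=
        Real.rpow_le_rpow (g_nonneg x) g_le (by linarith)
    _ ≤ 2 ^ (p - 1) * (R ^ p + (K * ‖(x : EuclideanSpace ℝ (Fin d))‖) ^ p) := add_rpow_le
    _ = 2 ^ (p - 1) * R ^ p + 2 ^ (p - 1) * K ^ p * ‖(x : EuclideanSpace ℝ (Fin d))‖ ^ p := by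
        rw [Real.mul_rpow K.coe_nonneg (norm_nonneg _)]
        ring

theorem tendsto_of_forall_hasGrowth {ι : Type*} {l : Filter ι} {μs : ι → ProbabilityMeasure Ω}
    (h : ∀ φ : Ω → ℝ, Continuous φ → HasGrowth p φ →
      Tendsto (fun i => ∫ x, φ x ∂(μs i : Measure Ω)) l (𝓝 (∫ x, φ x ∂(μ : Measure Ω)))) :
    Tendsto μs l (𝓝 μ) :=
  ProbabilityMeasure.tendsto_iff_forall_integral_tendsto.2 fun φ =>
    h φ φ.continuous ⟨‖φ‖, 0, fun x => by simpa using φ.norm_coe_le_norm x⟩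

theorem Wp_le_of_smul_le (hp : 0 < p) {δ C : ℝ≥0∞} (hδ : δ ≤ 1)
    (h : (1 - δ) • (μ : Measure Ω) ≤ ν)
    (hC : ∀ᵐ x ∂(μ : Measure Ω), ∀ᵐ y ∂(ν : Measure Ω), edist x y ^ p ≤ C) :
    Wp p μ ν ≤ (δ * C) ^ (1 / p) := by
  have : IsFiniteMeasure ((1 - δ) • (μ : Measure Ω)) := isFiniteMeasure_of_le (ν : Measure Ω) h
  set σ : Measure Ω := (ν : Measure Ω) - (1 - δ) • (μ : Measure Ω)
  have σ_add : σ + (1 - δ) • (μ : Measure Ω) = ν := Measure.sub_add_cancel_of_le h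
  have σ_univ : σ Set.univ = δ := by
    rw [Measure.sub_apply MeasurableSet.univ h]
    simp [ENNReal.sub_sub_cancel ENNReal.one_ne_top hδ]
  -- The common part `(1 - δ) • μ` stays in place, and the rest is spread independently as `σ`.
  let κ : Kernel Ω Ω :=
    { toFun x := σ + (1 - δ) • Measure.dirac x
      measurable' := Measure.measurable_of_measurable_coe _ fun s hs => by
        simpa [hs] using (measurable_one.indicator hs).const_mul _ |>.const_add _ }
  have κ_apply (x : Ω) : κ x = σ + (1 - δ) • Measure.dirac x := rfl
  have : IsMarkovKernel κ := ⟨fun x => ⟨by simp [κ_apply, σ_univ, hδ]⟩⟩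
  have κ_comp : κ ∘ₘ (μ : Measure Ω) = ν := by
    ext s hs
    rw [← σ_add, Measure.bind_apply hs κ.aemeasurable]
    simp only [κ_apply, Measure.add_apply, Measure.smul_apply, smul_eq_mul,
      Measure.dirac_apply' _ hs]
    rw [lintegral_add_left measurable_const, lintegral_const_mul _ (measurable_one.indicator hs),
      lintegral_indicator_one hs, lintegral_const, measure_univ, mul_one]
  refine (Wp_comp_le hp.le κ κ_comp).trans (ENNReal.rpow_le_rpow ?_ (by positivity))
  calc ∫⁻ x, ∫⁻ y, edist x y ^ p ∂κ x ∂(μ : Measure Ω)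
      = ∫⁻ x, ∫⁻ y, edist x y ^ p ∂σ ∂(μ : Measure Ω) := by
        simp [κ_apply, lintegral_add_measure, hp]
    _ ≤ ∫⁻ _, δ * C ∂(μ : Measure Ω) := by
        refine lintegral_mono_ae ?_
        filter_upwards [hC] with x hx
        refine (lintegral_mono_ae
          ((Measure.absolutelyContinuous_of_le Measure.sub_le).ae_le hx)).trans_eq ?_
        rw [lintegral_const, σ_univ, mul_comm]
    _ = δ * C := by simp

section TransportToQuantize

variable {ι : Type*} [Fintype ι]

theorem Wp_quantize_le (hp : 0 ≤ p) (f : PartitionOfUnity ι Ω Set.univ) (e : ι → Ω) {D : Ω → ℝ≥0∞}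
    (hD : ∀ i x, f i x ≠ 0 → edist x (e i) ^ p ≤ D x) (μ : ProbabilityMeasure Ω) :
    Wp p μ (quantize f e μ) ≤ (∫⁻ x, D x ∂(μ : Measure Ω)) ^ (1 / p) := by
  refine (Wp_comp_le hp (quantizationKernel f e) rfl).trans ?_
  gcongr with x
  calc ∫⁻ y, edist x y ^ p ∂quantizationKernel f e x
      = ∑ i, ENNReal.ofReal (f i x) * edist x (e i) ^ p := by
        simp [quantizationKernel_apply, lintegral_dirac]
    _ ≤ ∑ i, ENNReal.ofReal (f i x) * D x := by
        refine Finset.sum_le_sum fun i _ => ?_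
        rcases eq_or_ne (f i x) 0 with h_zero | h_ne
        · simp [h_zero]
        · gcongr
          exact hD i x h_ne
    _ = D x := by rw [← Finset.sum_mul, sum_ofReal_partitionOfUnity, one_mul]

theorem tendsto_Wp_quantize (hp : 0 < p) (f : PartitionOfUnity ι Ω Set.univ) (e : ι → Ω)
    {κ : Type*} {l : Filter κ} {μs : κ → ProbabilityMeasure Ω} (hμs : Tendsto μs l (𝓝 μ)) :
    Tendsto (fun n => Wp p (quantize f e μ) (quantize f e (μs n))) l (𝓝 0) := by
  let C : ℝ≥0∞ := ∑ i, ∑ j, edist (e i) (e j) ^ p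
  have C_ne_top : C ≠ ∞ := ENNReal.sum_ne_top.2 fun i _ => ENNReal.sum_ne_top.2 fun j _ =>
    ENNReal.rpow_ne_top_of_nonneg hp.le (edist_ne_top _ _)
  have le_C (i j : ι) : edist (e i) (e j) ^ p ≤ C :=
    (Finset.single_le_sum_of_canonicallyOrdered (f := fun j => edist (e i) (e j) ^ p)
      (Finset.mem_univ j)).trans (Finset.single_le_sum_of_canonicallyOrdered
        (f := fun i => ∑ j, edist (e i) (e j) ^ p) (Finset.mem_univ i))
  have eventually_le {δ : ℝ≥0∞} (hδ : 0 < δ) (hδ1 : δ ≤ 1) :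
      ∀ᶠ n in l, Wp p (quantize f e μ) (quantize f e (μs n)) ≤ (δ * C) ^ (1 / p) := by
    have one_sub_lt : 1 - δ < 1 := ENNReal.sub_lt_self ENNReal.one_ne_top one_ne_zero hδ.ne'
    filter_upwards [eventually_smul_quantize_le f e one_sub_lt hμs] with n hn
    refine Wp_le_of_smul_le hp hδ1 hn ?_
    filter_upwards [ae_mem_range_quantize f e μ]
    rintro _ ⟨i, rfl⟩
    filter_upwards [ae_mem_range_quantize f e (μs n)]
    rintro _ ⟨j, rfl⟩
    exact le_C i j
  have bound_tendsto : Tendsto (fun δ : ℝ≥0∞ => (δ * C) ^ (1 / p)) (𝓝[>] 0) (𝓝 0) := by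
    have mul_tendsto : Tendsto (fun δ : ℝ≥0∞ => δ * C) (𝓝 0) (𝓝 (0 * C)) :=
      ENNReal.Tendsto.mul_const tendsto_id (Or.inr C_ne_top)
    simpa [hp] using (mul_tendsto.mono_left nhdsWithin_le_nhds).ennrpow_const (1 / p)
  refine ENNReal.tendsto_nhds_zero.2 fun η hη => ?_
  obtain ⟨δ, hδη, hδ, hδ1⟩ := ((bound_tendsto.eventually_le_const hη).and
    (eventually_mem_nhdsWithin.and (nhdsWithin_le_nhds (Iic_mem_nhds zero_lt_one)))).exists
  exact (eventually_le hδ hδ1).mono fun n hn => hn.trans hδη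

end TransportToQuantize

theorem tendsto_lintegral_of_forall_hasGrowth {ι : Type*} {l : Filter ι} (hp : 0 ≤ p)
    {μs : ι → ProbabilityMeasure Ω} (hμ : moment p μ < ∞) (hμs : ∀ i, moment p (μs i) < ∞)
    (h : ∀ φ : Ω → ℝ, Continuous φ → HasGrowth p φ →
      Tendsto (fun i => ∫ x, φ x ∂(μs i : Measure Ω)) l (𝓝 (∫ x, φ x ∂(μ : Measure Ω))))
    {φ : Ω → ℝ} (hc : Continuous φ) (φ_nonneg : ∀ x, 0 ≤ φ x) (hφ : HasGrowth p φ) :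
    Tendsto (fun i => ∫⁻ x, ENNReal.ofReal (φ x) ∂(μs i : Measure Ω)) l
      (𝓝 (∫⁻ x, ENNReal.ofReal (φ x) ∂(μ : Measure Ω))) := by
  have lintegral_eq {ν : ProbabilityMeasure Ω} (hν : moment p ν < ∞) :
      ∫⁻ x, ENNReal.ofReal (φ x) ∂(ν : Measure Ω) = ENNReal.ofReal (∫ x, φ x ∂(ν : Measure Ω)) :=
    (ofReal_integral_eq_lintegral_ofReal (hφ.integrable hp hc hν)
      (Eventually.of_forall φ_nonneg)).symm
  simp only [lintegral_eq hμ, fun i => lintegral_eq (hμs i)]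
  exact (ENNReal.continuous_ofReal.tendsto _).comp (h φ hc hφ)

theorem exists_quantize_lintegral_rpow_lt (hp : 1 ≤ p) (hμ : moment p μ < ∞) {η : ℝ≥0∞}
    (hη : 0 < η) :
    ∃ (s : Finset Ω) (f : PartitionOfUnity s Ω Set.univ) (D : Ω → ℝ),
      Continuous D ∧ (∀ x, 0 ≤ D x) ∧ HasGrowth p D ∧
      (∀ ν : ProbabilityMeasure Ω, Wp p ν (quantize f Subtype.val ν) ≤
        (∫⁻ x, ENNReal.ofReal (D x) ∂(ν : Measure Ω)) ^ (1 / p)) ∧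
      (∫⁻ x, ENNReal.ofReal (D x) ∂(μ : Measure Ω)) ^ (1 / p) < η := by
  have hp0 : 0 < p := by linarith
  obtain ⟨x₀⟩ := μ.nonempty
  have lipschitz_dist : LipschitzWith 1 fun x => dist x x₀ + 1 := by
    simpa using (LipschitzWith.dist_left x₀).add (LipschitzWith.const (1 : ℝ))
  have dist_growth : HasGrowth p fun x : Ω => (dist x x₀ + 1) ^ p :=
    hasGrowth_rpow_of_lipschitzWith hp lipschitz_dist fun x => by positivity
  have dist_integrable := dist_growth.integrable hp0.le (by fun_prop (disch := simp [hp0.le])) hμ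
  obtain ⟨s, hs, ε, hε, hsη⟩ := exists_finset_lintegral_infDist_lt hp0 x₀ (μ : Measure Ω)
    dist_integrable.lintegral_lt_top.ne (ENNReal.rpow_pos_of_nonneg hη hp0.le)
  have : Nonempty s := hs.to_subtype
  obtain ⟨f, hf⟩ := exists_partitionOfUnity_dist_lt_infDist_add (Subtype.val : s → Ω) hε
  have lipschitz_infDist : LipschitzWith 1 fun x => Metric.infDist x (s : Set Ω) + ε := by
    simpa using (Metric.lipschitz_infDist_pt (s : Set Ω)).add (LipschitzWith.const ε)
  have infDist_add_nonneg (x : Ω) : 0 ≤ Metric.infDist x s + ε :=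
    add_nonneg Metric.infDist_nonneg hε.le
  refine ⟨s, f, fun x => (Metric.infDist x s + ε) ^ p,
    lipschitz_infDist.continuous.rpow_const fun _ => Or.inr hp0.le,
    fun x => Real.rpow_nonneg (infDist_add_nonneg x) p,
    hasGrowth_rpow_of_lipschitzWith hp lipschitz_infDist infDist_add_nonneg,
    fun ν => Wp_quantize_le hp0.le f _ (fun i x hx => ?_) ν, ?_⟩
  · rw [edist_dist, ENNReal.ofReal_rpow_of_nonneg dist_nonneg hp0.le]
    have dist_lt := hf i x hx
    rw [Subtype.range_coe] at dist_lt
    exact ENNReal.ofReal_le_ofReal (Real.rpow_le_rpow dist_nonneg dist_lt.le hp0.le)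
  · rwa [one_div, ENNReal.rpow_inv_lt_iff hp0]

theorem tendsto_Wp_of_forall_hasGrowth {ι : Type*} {l : Filter ι} (hΩ : MeasurableSet Ω)
    (hp : 1 ≤ p) {μs : ι → ProbabilityMeasure Ω} (hμ : moment p μ < ∞)
    (hμs : ∀ i, moment p (μs i) < ∞)
    (h : ∀ φ : Ω → ℝ, Continuous φ → HasGrowth p φ →
      Tendsto (fun i => ∫ x, φ x ∂(μs i : Measure Ω)) l (𝓝 (∫ x, φ x ∂(μ : Measure Ω)))) :
    Tendsto (fun i => Wp p (μs i) μ) l (𝓝 0) := by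
  have hp0 : 0 < p := by linarith
  refine ENNReal.tendsto_nhds_zero.2 fun η hη => ?_
  have third_pos : 0 < η / 3 := ENNReal.div_pos hη.ne' (by simp)
  obtain ⟨s, f, D, hD, D_nonneg, D_growth, Wp_le, D_lt⟩ :=
    exists_quantize_lintegral_rpow_lt hp hμ third_pos
  let Q : ProbabilityMeasure Ω → ProbabilityMeasure Ω := quantize f Subtype.val
  have D_tendsto := (tendsto_lintegral_of_forall_hasGrowth hp0.le hμ hμs h hD D_nonneg
    D_growth).ennrpow_const (1 / p)
  have Q_tendsto : Tendsto (fun i => Wp p (Q μ) (Q (μs i))) l (𝓝 0) :=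
    tendsto_Wp_quantize hp0 f _ (tendsto_of_forall_hasGrowth h)
  filter_upwards [D_tendsto.eventually_lt_const D_lt, Q_tendsto.eventually_lt_const third_pos]
    with i hDi hQi
  calc Wp p (μs i) μ ≤ Wp p (μs i) (Q (μs i)) + Wp p (Q (μs i)) μ := Wp_triangle hΩ hp _ _ _
    _ ≤ Wp p (μs i) (Q (μs i)) + (Wp p (Q (μs i)) (Q μ) + Wp p (Q μ) μ) := by
        gcongr
        exact Wp_triangle hΩ hp _ _ _
    _ = Wp p (μs i) (Q (μs i)) + (Wp p (Q μ) (Q (μs i)) + Wp p μ (Q μ)) := by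
        rw [Wp_comm (Q (μs i)), Wp_comm (Q μ) μ]
    _ ≤ η / 3 + (η / 3 + η / 3) :=
        add_le_add ((Wp_le _).trans hDi.le) (add_le_add hQi.le ((Wp_le _).trans D_lt.le))
    _ = η := by rw [← add_assoc, ENNReal.add_thirds]

end OptimalTransport

theorem mainTheorem3 (d : ℕ) (Ω : Set (EuclideanSpace ℝ (Fin d))) (hΩ : MeasurableSet Ω)
    (p : ℝ) (hp : 1 ≤ p) :
    -- the minimum in the definition of `W_p` is attained
    (∀ μ ν : ProbabilityMeasure Ω, ∃ γ, OptimalTransport.IsOptimalPlan p μ ν γ) ∧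
    -- `W_p` is a (finite) distance on the measures with finite `p`-th moment
    (∀ μ ∈ OptimalTransport.finiteMoment p Ω, ∀ ν ∈ OptimalTransport.finiteMoment p Ω,
      OptimalTransport.Wp p μ ν < ∞) ∧
    (∀ μ ∈ OptimalTransport.finiteMoment p Ω, ∀ ν ∈ OptimalTransport.finiteMoment p Ω,
      (OptimalTransport.Wp p μ ν = 0 ↔ μ = ν)) ∧
    (∀ μ ∈ OptimalTransport.finiteMoment p Ω, ∀ ν ∈ OptimalTransport.finiteMoment p Ω,
      OptimalTransport.Wp p μ ν = OptimalTransport.Wp p ν μ) ∧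
    (∀ μ ∈ OptimalTransport.finiteMoment p Ω, ∀ ν ∈ OptimalTransport.finiteMoment p Ω,
      ∀ ρ ∈ OptimalTransport.finiteMoment p Ω,
        OptimalTransport.Wp p μ ρ ≤ OptimalTransport.Wp p μ ν + OptimalTransport.Wp p ν ρ) ∧
    -- characterizations of convergence
    (∀ μ ∈ OptimalTransport.finiteMoment p Ω, ∀ μs : ℕ → ProbabilityMeasure Ω,
      (∀ n, μs n ∈ OptimalTransport.finiteMoment p Ω) →
        List.TFAE [
          Tendsto (fun n => OptimalTransport.Wp p (μs n) μ) atTop (𝓝 0),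
          Tendsto μs atTop (𝓝 μ) ∧
            Tendsto (fun n => OptimalTransport.moment p (μs n)) atTop
              (𝓝 (OptimalTransport.moment p μ)),
          ∀ φ : Ω → ℝ, Continuous φ → OptimalTransport.HasGrowth p φ →
            Tendsto (fun n => ∫ x, φ x ∂(μs n : Measure Ω)) atTop
              (𝓝 (∫ x, φ x ∂(μ : Measure Ω)))]) := by
  have hp0 : 0 < p := by linarith
  refine ⟨OptimalTransport.exists_isOptimalPlan hΩ p,
    fun _ hμ _ hν => OptimalTransport.Wp_lt_top hp hμ hν,
    fun _ _ _ _ => OptimalTransport.Wp_eq_zero_iff hp,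
    fun μ _ ν _ => OptimalTransport.Wp_comm μ ν,
    fun μ _ ν _ ρ _ => OptimalTransport.Wp_triangle hΩ hp μ ν ρ, fun μ hμ μs hμs => ?_⟩
  tfae_have 1 → 2 := fun h => ⟨OptimalTransport.tendsto_of_tendsto_Wp hp h,
    OptimalTransport.tendsto_moment_of_tendsto_Wp hp h⟩
  tfae_have 2 → 3 := fun ⟨h_weak, h_moment⟩ _ =>
    OptimalTransport.tendsto_integral_of_hasGrowth hp0.le hμ hμs h_weak h_moment
  tfae_have 3 → 1 := OptimalTransport.tendsto_Wp_of_forall_hasGrowth hΩ hp hμ hμs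
  tfae_finish
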